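/- For integers $N\ge 0$ let $D_N(x)=\sin((N+\tfrac12)x)/\sin(x/2)$ be the Dirichlet kernel (with $D_N(x)=2N+1$, its limiting value, when $x\in 2\pi\mathbb{Z}$), and let $K_N(x)=\frac{1}{N+1}\sum_{n=0}^{N}D_n(x)$ be the Fejér kernel. Assume the Riemann Hypothesis. Let $\tfrac12<\sigma<1$ and $x_0\in(-\pi,\pi)$. Then for every $N\ge 0$ the function $$y\mapsto\frac{K_N(x_0-2\tan^{-1}(2y))}{\zeta(\sigma+iy)\,(\frac14+y^2)}$$ is integrable on $\mathbb{R}$, and $$\lim_{N\to\infty}\frac{1}{2\pi}\int_{\mathbb{R}}\frac{K_N(x_0-2\tan^{-1}(2y))}{\zeta(\sigma+iy)\,(\frac14+y^2)}\,dy=\frac{1}{\zeta\!\left(\sigma+\frac{i}{2}\tan\frac{x_0}{2}\right)}.$$ -/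

import Mathlib

/-- The Dirichlet kernel `D_N(x) = sin ((N + 1/2) x) / sin (x / 2)`. At the removable singularities
`x ∈ 2πℤ` it takes its limiting value `2N + 1`. -/
noncomputable def dirichletKernel (N : ℕ) (x : ℝ) : ℝ :=
  if Real.sin (x / 2) = 0 then 2 * (N : ℝ) + 1
  else Real.sin (((N : ℝ) + 1 / 2) * x) / Real.sin (x / 2)

/-- The Fejér kernel `K_N(x) = (1 / (N + 1)) ∑_{n = 0}^N D_n(x)`. -/
noncomputable def fejerKernel (N : ℕ) (x : ℝ) : ℝ :=
  1 / ((N : ℝ) + 1) * ∑ n ∈ Finset.range (N + 1), dirichletKernel n x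

/-! The substitution `t = 2 arctan (2y)`, `dt = dy / (1/4 + y²)`, turns the integral into the Fejér
mean at `x₀` of `F(t) = 1 / ζ(σ + (i/2) tan (t/2))` on `(-π, π)`. Under RH `F` is continuous at
`x₀`, so Fejér's theorem (`tendsto_integral_fejerKernel_smul`) applies once `F` is integrable, that
is, once `1/ζ(σ + iy)` is integrable against `dy / (1/4 + y²)`.

Sublinear growth in `|y|` suffices (`RiemannHypothesis.exists_norm_inv_riemannZeta_le`). Under RH
the entire function `(s - 1) ζ(s)` has a holomorphic logarithm on the disc of radius 3/2 about `2 +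
iy`, normalised to vanish at the centre. Its real part is `O(log |y|)` for large `|y|` on that disc,
by a polynomial bound for `(s - 1) ζ(s)`, and `O(1)` on the disc of radius 1/2. By
`exists_norm_le_add_mul_of_re_le` the logarithm is then at most `C + ε log |y|` at `σ + iy`, with
`ε` as small as desired. -/

/-! ### Dirichlet and Fejér kernels. -/

theorem dirichletKernel_eq_sum_cos (n : ℕ) (x : ℝ) :
    dirichletKernel n x = 1 + 2 * ∑ k ∈ Finset.range n, Real.cos ((k + 1 : ℝ) * x) := by
  unfold dirichletKernel
  split_ifs with h
  · obtain ⟨m, hm⟩ := Real.sin_eq_zero_iff.mp h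
    have : ∀ k ∈ Finset.range n, Real.cos ((k + 1 : ℝ) * x) = 1 := by
      intro k _
      have hx : (k + 1 : ℝ) * x = (((k + 1 : ℕ) * m : ℤ) : ℝ) * (2 * Real.pi) := by
        push_cast; linear_combination (-2 * (k + 1 : ℝ)) * hm
      rw [hx, Real.cos_int_mul_two_pi]
    rw [Finset.sum_congr rfl this]
    simp; ring
  · rw [div_eq_iff h]
    induction n with
    | zero => simp; ring_nf
    | succ n ih =>
      rw [Finset.sum_range_succ]
      have h1 : Real.sin (((n + 1 : ℕ) + 1 / 2 : ℝ) * x)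
          = Real.sin ((n + 1 : ℝ) * x) * Real.cos (x / 2)
            + Real.cos ((n + 1 : ℝ) * x) * Real.sin (x / 2) := by
        rw [← Real.sin_add]; congr 1; push_cast; ring
      have h2 : Real.sin ((n + 1 / 2 : ℝ) * x)
          = Real.sin ((n + 1 : ℝ) * x) * Real.cos (x / 2)
            - Real.cos ((n + 1 : ℝ) * x) * Real.sin (x / 2) := by
        rw [← Real.sin_sub]; congr 1; ring
      rw [h1]; linear_combination ih - h2

theorem continuous_fejerKernel (N : ℕ) : Continuous (fejerKernel N) := by
  have : fejerKernel N = fun x => 1 / ((N : ℝ) + 1) * ∑ n ∈ Finset.range (N + 1),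
      (1 + 2 * ∑ k ∈ Finset.range n, Real.cos ((k + 1 : ℝ) * x)) := by
    ext x; simp only [fejerKernel, dirichletKernel_eq_sum_cos]
  rw [this]
  fun_prop

/-- The square gives both positivity and decay away from `2πℤ`. -/
theorem fejerKernel_eq_of_sin_ne_zero (N : ℕ) {x : ℝ} (h : Real.sin (x / 2) ≠ 0) :
    fejerKernel N x
      = 1 / ((N : ℝ) + 1) * (Real.sin (((N : ℝ) + 1) * x / 2) / Real.sin (x / 2)) ^ 2 := by
  unfold fejerKernel dirichletKernel
  simp only [h, if_false]
  congr 1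
  rw [← Finset.sum_div, div_pow, div_eq_div_iff h (pow_ne_zero 2 h)]
  suffices (∑ i ∈ Finset.range (N + 1), Real.sin (((i : ℝ) + 1 / 2) * x)) * Real.sin (x / 2)
      = Real.sin (((N : ℝ) + 1) * x / 2) ^ 2 by
    rw [← this]; ring
  induction N with
  | zero => simp; ring_nf
  | succ N ih =>
    rw [Finset.sum_range_succ, add_mul, ih]
    have h1 : Real.sin ((((N + 1 : ℕ) : ℝ) + 1) * x / 2)
        = Real.sin (((N : ℝ) + 1) * x / 2) * Real.cos (x / 2)
          + Real.cos (((N : ℝ) + 1) * x / 2) * Real.sin (x / 2) := by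
      rw [← Real.sin_add]; congr 1; push_cast; ring
    have h2 : Real.sin ((((N + 1 : ℕ) : ℝ) + 1 / 2) * x)
        = Real.sin (((N : ℝ) + 1) * x / 2) * Real.cos (((N : ℝ) + 1) * x / 2 + x / 2)
          + Real.cos (((N : ℝ) + 1) * x / 2) * Real.sin (((N : ℝ) + 1) * x / 2 + x / 2) := by
      rw [← Real.sin_add]; congr 1; push_cast; ring
    rw [h1, h2, Real.cos_add, Real.sin_add]
    have e1 := Real.sin_sq_add_cos_sq (x / 2)
    linear_combination (-Real.sin (((N : ℝ) + 1) * x / 2) ^ 2) * e1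

theorem fejerKernel_nonneg (N : ℕ) (x : ℝ) : 0 ≤ fejerKernel N x := by
  by_cases h : Real.sin (x / 2) = 0
  · unfold fejerKernel dirichletKernel
    simp only [h, if_true]
    positivity
  · rw [fejerKernel_eq_of_sin_ne_zero N h]
    positivity

theorem fejerKernel_le (N : ℕ) {x c : ℝ} (hc : 0 < c) (h : c ≤ |Real.sin (x / 2)|) :
    fejerKernel N x ≤ 1 / ((N : ℝ) + 1) * (1 / c ^ 2) := by
  have h0 : Real.sin (x / 2) ≠ 0 := abs_pos.mp (hc.trans_le h)
  rw [fejerKernel_eq_of_sin_ne_zero N h0, div_pow, ← sq_abs (Real.sin (x / 2))]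
  gcongr
  exact Real.sin_sq_le_one _

theorem integral_dirichletKernel_sub (n : ℕ) (a : ℝ) :
    ∫ x in (-Real.pi)..Real.pi, dirichletKernel n (a - x) = 2 * Real.pi := by
  simp only [dirichletKernel_eq_sum_cos]
  rw [intervalIntegral.integral_add, intervalIntegral.integral_const_mul,
    intervalIntegral.integral_finsetSum]
  · have : ∀ k ∈ Finset.range n,
        ∫ x in (-Real.pi)..Real.pi, Real.cos ((k + 1 : ℝ) * (a - x)) = 0 := by
      intro k _
      have hk : (k + 1 : ℝ) ≠ 0 := by positivity
      rw [intervalIntegral.integral_comp_sub_left (fun x => Real.cos ((k + 1 : ℝ) * x)),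
        intervalIntegral.integral_comp_mul_left _ hk, integral_cos]
      have : (k + 1 : ℝ) * (a - -Real.pi)
          = (k + 1 : ℝ) * (a - Real.pi) + ((k + 1 : ℕ) : ℝ) * (2 * Real.pi) := by
        push_cast; ring
      rw [this, Real.sin_add_nat_mul_two_pi]
      simp
    rw [Finset.sum_congr rfl this]
    simp; ring
  · intro k _; exact Continuous.intervalIntegrable (by fun_prop) _ _
  · exact Continuous.intervalIntegrable (by fun_prop) _ _
  · exact Continuous.intervalIntegrable (by fun_prop) _ _

theorem integral_fejerKernel_sub (N : ℕ) (a : ℝ) :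
    ∫ x in (-Real.pi)..Real.pi, fejerKernel N (a - x) = 2 * Real.pi := by
  unfold fejerKernel
  rw [intervalIntegral.integral_const_mul, intervalIntegral.integral_finsetSum]
  · simp only [integral_dirichletKernel_sub]
    have : (N + 1 : ℝ) ≠ 0 := by positivity
    simp; field_simp
  · intro n _
    simp only [dirichletKernel_eq_sum_cos]
    exact Continuous.intervalIntegrable (by fun_prop) _ _

/-! ### Polynomial growth of `(s - 1) ζ(s)` for `Re s > 1/2`. -/

theorem norm_ofReal_cpow_neg_sub_le {s : ℂ} (hs : 0 ≤ s.re) {a x : ℝ} (ha : 0 < a) (hx : a ≤ x) :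
    ‖(a : ℂ) ^ (-s) - (x : ℂ) ^ (-s)‖ ≤ ‖s‖ * a ^ (-s.re - 1) * (x - a) := by
  have key := (convex_Icc a x).norm_image_sub_le_of_norm_hasDerivWithin_le
    (f := fun t : ℝ => (t : ℂ) ^ (-s)) (f' := fun t : ℝ => -s * (t : ℂ) ^ (-s - 1))
    (C := ‖s‖ * a ^ (-s.re - 1)) (x := a) (y := x) ?_ ?_ (by simp [hx]) (by simp [hx])
  · rw [norm_sub_rev]
    simpa [abs_of_nonneg (sub_nonneg.mpr hx)] using key
  · intro t ht
    have ht0 : 0 < t := ha.trans_le ht.1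
    have := ((hasDerivAt_id (t : ℂ)).cpow_const (c := -s)
      (by simp [Complex.mem_slitPlane_iff, ht0])).comp_ofReal
    simpa using this.hasDerivWithinAt
  · intro t ht
    have ht0 : 0 < t := ha.trans_le ht.1
    rw [norm_mul, norm_neg, Complex.norm_cpow_eq_rpow_re_of_pos ht0]
    gcongr
    simpa using Real.rpow_le_rpow_of_nonpos ha ht.1 (by linarith : -s.re - 1 ≤ 0)

/-- The correction terms in the Euler--Maclaurin type expansion of `(s - 1) ζ(s)`. -/
noncomputable def zetaCorrection (n : ℕ) (s : ℂ) : ℂ :=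
  (s - 1) * ((n + 1 : ℝ) : ℂ) ^ (-s) + ((n + 2 : ℝ) : ℂ) ^ (1 - s) - ((n + 1 : ℝ) : ℂ) ^ (1 - s)

theorem differentiable_zetaCorrection (n : ℕ) : Differentiable ℂ (zetaCorrection n) := by
  have h1 : ((n + 1 : ℝ) : ℂ) ≠ 0 := Complex.ofReal_ne_zero.mpr (by positivity)
  have h2 : ((n + 2 : ℝ) : ℂ) ≠ 0 := Complex.ofReal_ne_zero.mpr (by positivity)
  unfold zetaCorrection
  refine ((Differentiable.mul (by fun_prop) ?_).add ?_).sub ?_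
  · exact Differentiable.const_cpow (by fun_prop) (Or.inl h1)
  · exact Differentiable.const_cpow (by fun_prop) (Or.inl h2)
  · exact Differentiable.const_cpow (by fun_prop) (Or.inl h1)

/-- The correction is `(s - 1) ∫ ((n+1)^(-s) - t^(-s)) dt` over `[n+1, n+2]`; the mean value
inequality replaces the integral. -/
theorem norm_zetaCorrection_le (n : ℕ) {s : ℂ} (hs : 0 ≤ s.re) :
    ‖zetaCorrection n s‖ ≤ ‖s - 1‖ * ‖s‖ * (n + 1 : ℝ) ^ (-s.re - 1) := by
  have ha : (0 : ℝ) < n + 1 := by positivity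
  have key := (convex_Icc (n + 1 : ℝ) (n + 2)).norm_image_sub_le_of_norm_hasDerivWithin_le
    (f := fun t : ℝ => (s - 1) * ((n + 1 : ℝ) : ℂ) ^ (-s) * (t : ℂ) + (t : ℂ) ^ (1 - s))
    (f' := fun t : ℝ => (s - 1) * (((n + 1 : ℝ) : ℂ) ^ (-s) - (t : ℂ) ^ (-s)))
    (C := ‖s - 1‖ * ‖s‖ * (n + 1 : ℝ) ^ (-s.re - 1)) (x := (n + 1 : ℝ)) (y := (n + 2 : ℝ))
    ?_ ?_ (by simp) (by simp)
  · have e : ((n : ℝ) + 2 - (n + 1)) = 1 := by ring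
    rw [e, norm_one, mul_one] at key
    refine le_trans (le_of_eq ?_) key
    congr 1
    unfold zetaCorrection
    push_cast
    ring
  · intro t ht
    have ht0 : 0 < t := ha.trans_le ht.1
    have h1 := ((hasDerivAt_id (t : ℂ)).cpow_const (c := 1 - s)
      (by simp [Complex.mem_slitPlane_iff, ht0]))
    have h2 := (hasDerivAt_id (t : ℂ)).const_mul ((s - 1) * ((n + 1 : ℝ) : ℂ) ^ (-s))
    have := (h2.add h1).comp_ofReal
    convert! this.hasDerivWithinAt using 1
    have e : (1 - s - 1 : ℂ) = -s := by ring
    simp only [id, e]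
    ring
  · intro t ht
    rw [norm_mul, mul_assoc]
    gcongr
    refine (norm_ofReal_cpow_neg_sub_le hs ha ht.1).trans ?_
    refine mul_le_of_le_one_right (by positivity) ?_
    linarith [ht.2]

theorem summable_nat_add_one_rpow {a : ℝ} (ha : a < -1) :
    Summable fun n : ℕ => (n + 1 : ℝ) ^ a := by
  have := (summable_nat_add_iff 1).mpr (Real.summable_nat_rpow.mpr ha)
  simpa using this

theorem norm_zetaCorrection_le_of_half_le (n : ℕ) {s : ℂ} (hs : 1 / 2 ≤ s.re) :
    ‖zetaCorrection n s‖ ≤ ‖s - 1‖ * ‖s‖ * (n + 1 : ℝ) ^ (-3 / 2 : ℝ) := by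
  refine (norm_zetaCorrection_le n (by linarith)).trans ?_
  gcongr
  · linarith [n.cast_nonneg (α := ℝ)]
  · linarith

theorem summable_zetaCorrection {s : ℂ} (hs : 1 / 2 ≤ s.re) :
    Summable fun n => zetaCorrection n s :=
  .of_norm_bounded ((summable_nat_add_one_rpow (by norm_num)).mul_left _)
    fun n => norm_zetaCorrection_le_of_half_le n hs

open Filter Topology in
theorem riemannZeta₁_eq_of_one_lt_re {s : ℂ} (hs : 1 < s.re) :
    riemannZeta₁ s = 1 + ∑' n, zetaCorrection n s := by
  have hs1 : s ≠ 1 := by rintro rfl; simp at hs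
  have hg : riemannZeta₁ s = (s - 1) * riemannZeta s := by
    rw [riemannZeta_eq_inv_sub_mul hs1, mul_inv_cancel_left₀ (sub_ne_zero.mpr hs1)]
  have hz : HasSum (fun n : ℕ => ((n + 1 : ℝ) : ℂ) ^ (-s)) (riemannZeta s) := by
    rw [zeta_eq_tsum_one_div_nat_add_one_cpow hs]
    have : Summable fun n : ℕ => 1 / ((n : ℂ) + 1) ^ s := by
      simpa using (summable_nat_add_iff 1).mpr (Complex.summable_one_div_nat_cpow.mpr hs)
    convert! this.hasSum using 2 with n
    rw [Complex.cpow_neg]; push_cast; simp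
  -- The powers with exponent `1 - s` telescope.
  have hp : ∀ N : ℕ, ∑ n ∈ Finset.range N, zetaCorrection n s
      = (s - 1) * ∑ n ∈ Finset.range N, ((n + 1 : ℝ) : ℂ) ^ (-s)
        + ((N + 1 : ℝ) : ℂ) ^ (1 - s) - 1 := by
    intro N
    induction N with
    | zero => simp
    | succ N ih =>
      rw [Finset.sum_range_succ, ih, Finset.sum_range_succ, zetaCorrection]
      push_cast
      ring_nf
  have h0 : Tendsto (fun N : ℕ => ((N + 1 : ℝ) : ℂ) ^ (1 - s)) atTop (𝓝 0) := by
    rw [tendsto_zero_iff_norm_tendsto_zero]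
    have h1 : Tendsto (fun N : ℕ => (N + 1 : ℝ) ^ (-(s.re - 1))) atTop (𝓝 0) :=
      (tendsto_rpow_neg_atTop (by linarith)).comp
        (tendsto_atTop_add_const_right _ _ tendsto_natCast_atTop_atTop)
    refine h1.congr fun N => ?_
    rw [Complex.norm_cpow_eq_rpow_re_of_pos (by positivity)]
    simp
  have h2 := ((hz.tendsto_sum_nat.const_mul (s - 1)).add h0).sub_const 1
  have h3 := (summable_zetaCorrection (s := s) (by linarith)).hasSum.tendsto_sum_nat
  have := tendsto_nhds_unique (h3.congr hp) h2
  rw [this, hg]; ring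

open Filter Topology in
theorem riemannZeta₁_eq_tsum_zetaCorrection {s : ℂ} (hs : 1 / 2 < s.re) :
    riemannZeta₁ s = 1 + ∑' n, zetaCorrection n s := by
  set K : ℝ := ‖s‖ + 3
  -- The ball makes the majorant uniform in `z`; the identity theorem then continues from a
  -- neighbourhood of `2` to `s`.
  set U : Set ℂ := {z | 1 / 2 < z.re} ∩ Metric.ball 0 K
  have hUo : IsOpen U := (isOpen_lt continuous_const Complex.continuous_re).inter Metric.isOpen_ball
  have hUc : Convex ℝ U := (convex_halfSpace_re_gt _).inter (convex_ball _ _)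
  have hd : DifferentiableOn ℂ (fun z => 1 + ∑' n, zetaCorrection n z) U := by
    refine (differentiableOn_const 1).add ?_
    refine Complex.differentiableOn_tsum_of_summable_norm
      (u := fun n => (K + 1) * K * (n + 1 : ℝ) ^ (-3 / 2 : ℝ))
      ((summable_nat_add_one_rpow (by norm_num)).mul_left _)
      (fun n => (differentiable_zetaCorrection n).differentiableOn) hUo ?_
    intro n w hw
    have hw2 : ‖w‖ ≤ K := (mem_ball_zero_iff.mp hw.2).le
    have hw1 : ‖w - 1‖ ≤ K + 1 := (norm_sub_le _ _).trans (by simpa using hw2)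
    refine (norm_zetaCorrection_le_of_half_le n hw.1.le).trans ?_
    gcongr
  have h2 : (2 : ℂ) ∈ U := by
    refine ⟨by norm_num, ?_⟩
    simp only [Metric.mem_ball, dist_zero_right, K]
    norm_num
    linarith [norm_nonneg s]
  refine (differentiable_riemannZeta₁.differentiableOn.analyticOnNhd
    hUo).eqOn_of_preconnected_of_eventuallyEq (hd.analyticOnNhd hUo) hUc.isPreconnected h2 ?_
      (⟨hs, by simp [K]⟩ : s ∈ U)
  filter_upwards [(isOpen_lt continuous_const Complex.continuous_re).mem_nhds
    (by norm_num : (1 : ℝ) < (2 : ℂ).re)] with z hz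
  exact riemannZeta₁_eq_of_one_lt_re hz

theorem exists_norm_riemannZeta₁_le : ∃ K : ℝ, 0 ≤ K ∧ ∀ s : ℂ, 1 / 2 < s.re →
    ‖riemannZeta₁ s‖ ≤ 1 + ‖s - 1‖ * ‖s‖ * K := by
  refine ⟨∑' n : ℕ, (n + 1 : ℝ) ^ (-3 / 2 : ℝ), tsum_nonneg fun n => by positivity,
    fun s hs => ?_⟩
  have hsum := (summable_nat_add_one_rpow (a := -3 / 2) (by norm_num)).mul_left (‖s - 1‖ * ‖s‖)
  rw [riemannZeta₁_eq_tsum_zetaCorrection hs, ← tsum_mul_left]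
  refine (norm_add_le _ _).trans ?_
  rw [norm_one]
  gcongr
  exact tsum_of_norm_bounded hsum.hasSum fun n => norm_zetaCorrection_le_of_half_le n hs.le

/-! ### Holomorphic logarithms and Taylor coefficient bounds. -/

open Metric in
theorem exists_exp_eq_div_of_ne_zero {g : ℂ → ℂ} {c : ℂ} {R : ℝ} (hR : 0 < R)
    (hg : DifferentiableOn ℂ g (ball c R)) (h0 : ∀ z ∈ ball c R, g z ≠ 0) :
    ∃ h : ℂ → ℂ, DifferentiableOn ℂ h (ball c R) ∧ h c = 0 ∧
      ∀ z ∈ ball c R, Complex.exp (h z) = g z / g c := by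
  have hc : c ∈ ball c R := mem_ball_self hR
  have hd : DifferentiableOn ℂ (fun z => deriv g z / g z) (ball c R) :=
    (hg.deriv isOpen_ball).div hg h0
  -- The logarithm is a primitive of `g'/g`.
  obtain ⟨h, hhc, hh⟩ := hd.isExactOn_ball.with_val_at c 0
  refine ⟨h, fun z hz => (hh z hz).differentiableAt.differentiableWithinAt, hhc, fun z hz => ?_⟩
  have hder : ∀ w ∈ ball c R, HasDerivAt (fun w => g w * Complex.exp (-h w)) 0 w := by
    intro w hw
    have hgw := (hg.differentiableAt (isOpen_ball.mem_nhds hw)).hasDerivAt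
    have := hgw.mul (hh w hw).neg.cexp
    convert! this using 1
    have := h0 w hw
    field_simp
    ring
  have hconst : g z * Complex.exp (-h z) = g c * Complex.exp (-h c) := by
    refine (convex_ball c R).is_const_of_fderivWithin_eq_zero (𝕜 := ℂ)
      (f := fun w => g w * Complex.exp (-h w))
      (fun w hw => (hder w hw).differentiableAt.differentiableWithinAt) ?_ hz hc
    intro w hw
    rw [fderivWithin_of_isOpen isOpen_ball hw]
    ext
    simp [(hder w hw).deriv]
  rw [hhc, neg_zero, Complex.exp_zero, mul_one, Complex.exp_neg,
    ← div_eq_mul_inv, div_eq_iff (Complex.exp_ne_zero _)] at hconst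
  rw [eq_div_iff (h0 c hc), mul_comm, hconst]

-- Borel–Carathéodory bounds `h` on the circle of radius `r`; Cauchy's estimates then bound its
-- Taylor coefficients.
open Metric Nat in
theorem norm_taylor_term_le_of_re_le {h : ℂ → ℂ} {A r R : ℝ} (hA : 0 < A)
    (hd : DifferentiableOn ℂ h (ball 0 R)) (h0 : h 0 = 0) (hre : ∀ z ∈ ball 0 R, (h z).re ≤ A)
    (hr : 0 < r) (hrR : r < R) (n : ℕ) (z : ℂ) :
    ‖(n ! : ℂ)⁻¹ • (z - 0) ^ n • iteratedDeriv n h 0‖ ≤ 2 * A * r / (R - r) * (‖z‖ / r) ^ n := by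
  have hB : ∀ w ∈ sphere (0 : ℂ) r, ‖h w‖ ≤ 2 * A * r / (R - r) := by
    intro w hw
    have hw' : ‖w‖ = r := by simpa using hw
    have := Complex.borelCaratheodory_zero hA hd hre (hr.trans hrR) (z := w)
      (by simpa [hw'] using hrR) h0
    rwa [hw'] at this
  have hdc : DiffContOnCl ℂ h (ball 0 r) :=
    (hd.mono (closedBall_subset_ball hrR)).diffContOnCl_ball subset_rfl
  have := Complex.norm_iteratedDeriv_le_of_forall_mem_sphere_norm_le n hr hdc hB
  rw [norm_smul, norm_smul, norm_inv, norm_pow, sub_zero, RCLike.norm_natCast]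
  have hn : (0 : ℝ) < n ! := by exact_mod_cast n.factorial_pos
  calc (n ! : ℝ)⁻¹ * (‖z‖ ^ n * ‖iteratedDeriv n h 0‖)
      ≤ (n ! : ℝ)⁻¹ * (‖z‖ ^ n * (n ! * (2 * A * r / (R - r)) / r ^ n)) := by gcongr
    _ = 2 * A * r / (R - r) * (‖z‖ / r) ^ n := by
      rw [div_pow]; field_simp

open Metric Filter Topology in
/-- If the real part of a holomorphic function vanishing at the centre of a disc is at most `A` on
the disc and at most `M` on a smaller concentric disc, then the function grows sublinearly in `A`
on every compact subdisc. -/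
theorem exists_norm_le_add_mul_of_re_le {r ρ R M ε : ℝ} (hr : 0 < r) (hrR : r ≤ R) (hρ : 0 ≤ ρ)
    (hρR : ρ < R) (hM : 0 < M) (hε : 0 < ε) :
    ∃ C : ℝ, ∀ (h : ℂ → ℂ) (A : ℝ), 0 < A → DifferentiableOn ℂ h (ball 0 R) → h 0 = 0 →
      (∀ z ∈ ball 0 R, (h z).re ≤ A) → (∀ z ∈ ball 0 r, (h z).re ≤ M) →
      ∀ z, ‖z‖ ≤ ρ → ‖h z‖ ≤ C + ε * A := by
  obtain ⟨R', hρR', hR'R⟩ := exists_between hρR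
  have hR' : 0 < R' := hρ.trans_lt hρR'
  set q := ρ / R'
  have hq0 : 0 ≤ q := by positivity
  have hq1 : q < 1 := (div_lt_one hR').mpr hρR'
  have hlim : Tendsto (fun N : ℕ => 2 * R' / (R - R') * (q ^ N * (1 - q)⁻¹)) atTop (𝓝 0) := by
    simpa using ((tendsto_pow_atTop_nhds_zero_of_lt_one hq0 hq1).mul_const (1 - q)⁻¹).const_mul
      (2 * R' / (R - R'))
  -- `N` depends only on the radii and `ε`. Terms below `N` are bounded through the inner disc,
  -- independently of `A`; the geometric tail is at most `ε * A`.
  obtain ⟨N, hN⟩ := (hlim.eventually_le_const hε).exists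
  refine ⟨∑ n ∈ Finset.range N, 2 * M * (r / 2) / (r - r / 2) * (ρ / (r / 2)) ^ n, ?_⟩
  intro h A hA hd h0 hreA hreM z hz
  have hzR : z ∈ ball (0 : ℂ) R := by simpa using hz.trans_lt hρR
  have hT := Complex.hasSum_taylorSeries_on_ball hd hzR
  rw [← hT.tsum_eq, ← hT.summable.sum_add_tsum_nat_add N]
  have hrem : HasSum (fun n : ℕ => 2 * A * R' / (R - R') * q ^ (n + N))
      (ε * A - (ε * A - 2 * A * R' / (R - R') * (q ^ N * (1 - q)⁻¹))) := by
    have := ((hasSum_geometric_of_lt_one hq0 hq1).mul_left (q ^ N)).mul_left (2 * A * R' / (R - R'))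
    convert! this using 1
    · ext n; rw [pow_add, mul_comm (q ^ n)]
    · ring
  refine (norm_add_le _ _).trans (add_le_add ?_ ?_)
  · refine norm_sum_le_of_le _ fun n _ => ?_
    refine (norm_taylor_term_le_of_re_le hM (hd.mono (ball_subset_ball hrR)) h0 hreM
      (half_pos hr) (half_lt_self hr) n z).trans ?_
    have : 0 < r - r / 2 := by linarith
    gcongr
  · refine (tsum_of_norm_bounded hrem fun n => ?_).trans ?_
    · refine (norm_taylor_term_le_of_re_le hA hd h0 hreA hR' hR'R (n + N) z).trans ?_
      have : 0 < R - R' := by linarith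
      gcongr
      exact div_le_div_of_nonneg_right hz hR'.le
    · have : 2 * A * R' / (R - R') * (q ^ N * (1 - q)⁻¹)
          = A * (2 * R' / (R - R') * (q ^ N * (1 - q)⁻¹)) := by ring
      rw [this]
      have := mul_le_mul_of_nonneg_left hN hA.le
      linarith

/-! ### Bounds for `ζ` and `1/ζ`. -/

theorem exists_norm_riemannZeta_le_and_norm_inv_le : ∃ B : ℝ, 0 < B ∧ ∀ s : ℂ, 3 / 2 ≤ s.re →
    ‖riemannZeta s‖ ≤ B ∧ ‖(riemannZeta s)⁻¹‖ ≤ B := by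
  have hsum := summable_nat_add_one_rpow (a := -3 / 2) (by norm_num)
  have hpos : 0 < ∑' n : ℕ, (n + 1 : ℝ) ^ (-3 / 2 : ℝ) :=
    hsum.tsum_pos (fun n => by positivity) 0 (by positivity)
  refine ⟨_, hpos, fun s hs => ⟨?_, ?_⟩⟩
  · rw [zeta_eq_tsum_one_div_nat_add_one_cpow (by linarith)]
    refine tsum_of_norm_bounded hsum.hasSum fun n => ?_
    have e : (n : ℂ) + 1 = ((n + 1 : ℝ) : ℂ) := by push_cast; rfl
    rw [norm_div, norm_one, e, Complex.norm_cpow_eq_rpow_re_of_pos (by positivity), one_div,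
      ← Real.rpow_neg (by positivity)]
    gcongr
    · linarith [n.cast_nonneg (α := ℝ)]
    · linarith
  · have h1 := ArithmeticFunction.LSeries_zeta_mul_Lseries_moebius (s := s) (by linarith)
    rw [ArithmeticFunction.LSeries_zeta_eq_riemannZeta (by linarith)] at h1
    rw [inv_eq_of_mul_eq_one_right h1, LSeries]
    have hs0 : HasSum (fun n : ℕ => if n = 0 then (0 : ℝ) else (n : ℝ) ^ (-3 / 2 : ℝ))
        (∑' n : ℕ, (n + 1 : ℝ) ^ (-3 / 2 : ℝ)) := by
      rw [← hasSum_nat_add_iff' 1]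
      simpa using hsum.hasSum
    refine tsum_of_norm_bounded hs0 fun n => ?_
    rw [LSeries.norm_term_eq]
    split_ifs with hn
    · exact le_rfl
    · have hn1 : (1 : ℝ) ≤ n := by exact_mod_cast Nat.one_le_iff_ne_zero.mpr hn
      have hμ : ‖((ArithmeticFunction.moebius n : ℤ) : ℂ)‖ ≤ 1 := by
        rw [Complex.norm_intCast]
        exact_mod_cast ArithmeticFunction.abs_moebius_le_one
      rw [div_eq_mul_inv, ← Real.rpow_neg (by positivity)]
      refine (mul_le_of_le_one_left (by positivity) hμ).trans ?_
      gcongr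
      linarith

theorem RiemannHypothesis.riemannZeta_ne_zero (hRH : RiemannHypothesis) {s : ℂ}
    (hs : 1 / 2 < s.re) (hs1 : s ≠ 1) : riemannZeta s ≠ 0 := by
  intro h
  refine hs.ne' (hRH s h ?_ hs1)
  rintro ⟨n, rfl⟩
  have : ((-2 * ((n : ℂ) + 1)).re) = -2 * ((n : ℝ) + 1) := by simp
  rw [this] at hs
  linarith [n.cast_nonneg (α := ℝ)]

theorem RiemannHypothesis.riemannZeta₁_ne_zero (hRH : RiemannHypothesis) {s : ℂ}
    (hs : 1 / 2 < s.re) : riemannZeta₁ s ≠ 0 := by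
  by_cases h : s = 1
  · simp [h]
  · intro h0
    apply hRH.riemannZeta_ne_zero hs h
    rw [riemannZeta_eq_inv_sub_mul h, h0, mul_zero]

theorem riemannZeta₁_eq_mul {s : ℂ} (hs : s ≠ 1) :
    riemannZeta₁ s = (s - 1) * riemannZeta s := by
  rw [riemannZeta_eq_inv_sub_mul hs, mul_inv_cancel_left₀ (sub_ne_zero.mpr hs)]

open Metric in
/-- Under the Riemann hypothesis, `1 / ζ` is `O(|y| ^ (1 / 2))` on each vertical line in the right
half of the critical strip. -/
theorem RiemannHypothesis.exists_norm_inv_riemannZeta_le (hRH : RiemannHypothesis) {σ : ℝ}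
    (hσ : 1 / 2 < σ) (hσ' : σ < 1) :
    ∃ C : ℝ, ∀ y : ℝ, ‖(riemannZeta ((σ : ℂ) + Complex.I * (y : ℂ)))⁻¹‖
      ≤ C * (4 + |y|) ^ (1 / 2 : ℝ) := by
  obtain ⟨K, hK, hgK⟩ := exists_norm_riemannZeta₁_le
  obtain ⟨B, hB, hζB⟩ := exists_norm_riemannZeta_le_and_norm_inv_le
  set M : ℝ := |Real.log (2 * B * B)| + 1
  set L : ℝ := |Real.log ((1 + K) * B)|
  -- About `2 + iy`, radius `3/2` reaches `Re = 1/2`, radius `1/2` stays in `Re > 3/2`, and `σ + iy`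
  -- lies at distance `2 - σ`. With `A = L + 2 log Y`, `ε = 1/4` yields the exponent `1/2`.
  obtain ⟨C, hC⟩ := exists_norm_le_add_mul_of_re_le (r := 1 / 2) (R := 3 / 2) (ρ := 2 - σ)
    (M := M) (ε := 1 / 4) (by norm_num) (by norm_num) (by linarith) (by linarith)
    (by positivity) (by norm_num)
  refine ⟨3 * B * Real.exp (C + 1 / 4 * L), fun y => ?_⟩
  set Y : ℝ := 4 + |y|
  have hY : 4 ≤ Y := by simp [Y]
  set c : ℂ := 2 + Complex.I * y
  have hcre : c.re = 2 := by simp [c]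
  have hc1 : 1 ≤ ‖c - 1‖ := by
    refine le_trans ?_ (Complex.re_le_norm _)
    simp [hcre]; norm_num
  have hc1' : c ≠ 1 := by rintro h; simp [h] at hc1; linarith
  have hcn : ‖c‖ ≤ 2 + |y| := by
    refine (norm_add_le _ _).trans ?_
    simp
  have hgc : ‖(riemannZeta₁ c)⁻¹‖ ≤ ‖c - 1‖⁻¹ * B := by
    rw [riemannZeta₁_eq_mul hc1', mul_inv, norm_mul, norm_inv]
    gcongr
    exact (hζB c (by rw [hcre]; norm_num)).2
  have hgcB : ‖(riemannZeta₁ c)⁻¹‖ ≤ B :=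
    hgc.trans (mul_le_of_le_one_left hB.le (inv_le_one_of_one_le₀ hc1))
  have hball : ∀ {r : ℝ} {z : ℂ}, z ∈ ball c r → 2 - r < z.re := by
    intro r z hz
    have h1 := (Complex.abs_re_le_norm (z - c)).trans_lt (mem_ball_iff_norm.mp hz)
    rw [Complex.sub_re, hcre] at h1
    linarith [(abs_lt.mp h1).1]
  obtain ⟨h, hhd, hhc, hh⟩ := exists_exp_eq_div_of_ne_zero (g := riemannZeta₁) (c := c)
    (R := 3 / 2) (by norm_num) differentiable_riemannZeta₁.differentiableOn
    (fun z hz => hRH.riemannZeta₁_ne_zero (by linarith [hball hz]))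
  have hnorm : ∀ z ∈ ball c (3 / 2), Real.exp (h z).re
      = ‖riemannZeta₁ z‖ * ‖(riemannZeta₁ c)⁻¹‖ := by
    intro z hz
    rw [← Complex.norm_exp, hh z hz, norm_div, norm_inv, div_eq_mul_inv]
  have hmem : ∀ {r : ℝ} {z : ℂ}, z ∈ ball (0 : ℂ) r → z + c ∈ ball c r := by
    intro r z hz; simpa using hz
  have hA : ∀ z ∈ ball (0 : ℂ) (3 / 2), (h (z + c)).re ≤ L + 2 * Real.log Y := by
    intro z hz
    have hz' := hmem hz
    have hw : ‖z + c‖ ≤ Y := by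
      refine (norm_add_le _ _).trans ?_
      have := mem_ball_zero_iff.mp hz
      simp only [Y]; linarith
    have hw1 : ‖z + c - 1‖ ≤ Y := by
      have e : z + c - 1 = z + (1 + Complex.I * y) := by simp only [c]; ring
      have h2 : ‖1 + Complex.I * (y : ℂ)‖ ≤ 1 + |y| := by
        refine (norm_add_le _ _).trans ?_
        simp
      rw [e]
      refine (norm_add_le _ _).trans ?_
      have := mem_ball_zero_iff.mp hz
      simp only [Y]; linarith
    have hg : ‖riemannZeta₁ (z + c)‖ ≤ (1 + K) * Y ^ 2 := by
      refine (hgK _ (by linarith [hball hz'])).trans ?_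
      have : ‖z + c - 1‖ * ‖z + c‖ * K ≤ Y * Y * K := by gcongr
      nlinarith
    have hexp : Real.exp (h (z + c)).re ≤ (1 + K) * B * Y ^ 2 := by
      rw [hnorm _ hz']
      calc _ ≤ (1 + K) * Y ^ 2 * B := by gcongr
        _ = _ := by ring
    rw [← Real.le_log_iff_exp_le (by positivity),
      Real.log_mul (by positivity) (by positivity), Real.log_pow] at hexp
    exact hexp.trans (add_le_add (le_abs_self _) (by simp))
  have hM : ∀ z ∈ ball (0 : ℂ) (1 / 2), (h (z + c)).re ≤ M := by
    intro z hz
    have hz' := hmem hz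
    have hz'' : z + c ∈ ball c (3 / 2) := ball_subset_ball (by norm_num) hz'
    have hre := hball hz'
    have hne : z + c ≠ 1 := by intro h; rw [h] at hre; norm_num at hre
    have hw1 : ‖z + c - 1‖ ≤ 2 * ‖c - 1‖ := by
      have e : z + c - 1 = z + (c - 1) := by ring
      rw [e]
      refine (norm_add_le _ _).trans ?_
      linarith [mem_ball_zero_iff.mp hz]
    -- The factor `‖c - 1‖` cancels, so the bound is independent of `y`.
    have hexp : Real.exp (h (z + c)).re ≤ 2 * B * B := by
      rw [hnorm _ hz'', riemannZeta₁_eq_mul hne, norm_mul]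
      calc _ ≤ 2 * ‖c - 1‖ * B * (‖c - 1‖⁻¹ * B) := by
            gcongr
            exact (hζB _ (by linarith)).1
        _ = _ := by field_simp
    rw [← Real.le_log_iff_exp_le (by positivity)] at hexp
    refine hexp.trans ((le_abs_self _).trans ?_)
    simp [M]
  have hlog : 0 < Real.log Y := Real.log_pos (by linarith)
  set s : ℂ := (σ : ℂ) + Complex.I * y
  have hsc : s = ((σ - 2 : ℝ) : ℂ) + c := by simp only [s, c]; push_cast; ring
  have hρ : ‖((σ - 2 : ℝ) : ℂ)‖ = 2 - σ := by
    rw [Complex.norm_real, Real.norm_eq_abs, abs_of_neg (by linarith)]; ring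
  have hH := hC (fun z => h (z + c)) (L + 2 * Real.log Y) (by positivity)
    (hhd.comp (by fun_prop) fun z hz => hmem hz) (by simpa using hhc) hA hM
    ((σ - 2 : ℝ) : ℂ) hρ.le
  rw [← hsc] at hH
  have hsball : s ∈ ball c (3 / 2) := by
    rw [hsc]; exact hmem (by rw [mem_ball_zero_iff, hρ]; linarith)
  have hs1 : s ≠ 1 := by
    intro h
    have : s.re = σ := by simp [s]
    rw [h, Complex.one_re] at this
    linarith
  have hexp : Real.exp (-(h s).re) ≤ Real.exp (C + 1 / 4 * L) * Y ^ (1 / 2 : ℝ) := by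
    rw [Real.rpow_def_of_pos (by linarith), ← Real.exp_add, Real.exp_le_exp]
    have := (abs_le.mp (Complex.abs_re_le_norm (h s))).1
    linarith
  have hgs : ‖(riemannZeta₁ s)⁻¹‖ = ‖(riemannZeta₁ c)⁻¹‖ * Real.exp (-(h s).re) := by
    rw [Real.exp_neg, hnorm s hsball, mul_inv, norm_inv, norm_inv, inv_inv]
    have : ‖riemannZeta₁ c‖ ≠ 0 :=
      norm_ne_zero_iff.mpr (hRH.riemannZeta₁_ne_zero (by rw [hcre]; norm_num))
    field_simp
  have hsub : ‖s - 1‖ ≤ 3 * ‖c - 1‖ := by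
    have e : s - 1 = ((σ - 2 : ℝ) : ℂ) + (c - 1) := by rw [hsc]; ring
    rw [e]
    refine (norm_add_le _ _).trans ?_
    rw [hρ]; linarith
  calc ‖(riemannZeta s)⁻¹‖ = ‖s - 1‖ * ‖(riemannZeta₁ s)⁻¹‖ := by
        rw [riemannZeta_eq_inv_sub_mul hs1, mul_inv, inv_inv, norm_mul]
    _ ≤ (3 * ‖c - 1‖) * ((‖c - 1‖⁻¹ * B) * (Real.exp (C + 1 / 4 * L) * Y ^ (1 / 2 : ℝ))) := by
        rw [hgs]; gcongr
    _ = 3 * B * Real.exp (C + 1 / 4 * L) * Y ^ (1 / 2 : ℝ) := by field_simp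

/-! ### The change of variables and Fejér's theorem. -/

open MeasureTheory Real in
theorem hasDerivAt_two_mul_arctan_two_mul (y : ℝ) :
    HasDerivAt (fun y : ℝ => 2 * arctan (2 * y)) (1 / (1 / 4 + y ^ 2)) y := by
  have h := (((hasDerivAt_id y).const_mul 2).arctan).const_mul 2
  convert! h using 1
  have : (1 + (2 * y) ^ 2 : ℝ) ≠ 0 := by positivity
  have : (1 / 4 + y ^ 2 : ℝ) ≠ 0 := by positivity
  simp only [id]
  field_simp
  ring

theorem injective_two_mul_arctan_two_mul :
    Function.Injective fun y : ℝ => 2 * Real.arctan (2 * y) := by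
  intro a b h
  have := Real.arctan_injective (mul_left_cancel₀ two_ne_zero h)
  linarith

theorem image_two_mul_arctan_two_mul :
    (fun y : ℝ => 2 * Real.arctan (2 * y)) '' Set.univ = Set.Ioo (-Real.pi) Real.pi := by
  ext t
  simp only [Set.image_univ, Set.mem_range, Set.mem_Ioo]
  constructor
  · rintro ⟨y, rfl⟩
    constructor
    · linarith [Real.neg_pi_div_two_lt_arctan (2 * y)]
    · linarith [Real.arctan_lt_pi_div_two (2 * y)]
  · rintro ⟨h1, h2⟩
    refine ⟨Real.tan (t / 2) / 2, ?_⟩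
    rw [mul_div_cancel₀ _ two_ne_zero, Real.arctan_tan (by linarith) (by linarith)]
    ring

open MeasureTheory Filter Topology in
/-- **Fejér's theorem**: the Fejér means of an integrable function converge at every interior point
of continuity. -/
theorem tendsto_integral_fejerKernel_smul {E : Type*} [NormedAddCommGroup E] [NormedSpace ℝ E]
    [CompleteSpace E] {F : ℝ → E} {x₀ : ℝ} (hx₀ : x₀ ∈ Set.Ioo (-Real.pi) Real.pi)
    (hF : IntegrableOn F (Set.Ioo (-Real.pi) Real.pi)) (hc : ContinuousAt F x₀) :
    Tendsto (fun N : ℕ => ∫ t in Set.Ioo (-Real.pi) Real.pi,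
      (fejerKernel N (x₀ - t) / (2 * Real.pi)) • F t) atTop (𝓝 (F x₀)) := by
  have hpi := Real.pi_pos
  refine tendsto_setIntegral_peak_smul_of_integrableOn_of_tendsto measurableSet_Ioo
    measurableSet_Ioo subset_rfl self_mem_nhdsWithin (by simp) ?_ ?_ ?_ ?_ hF
    (hc.tendsto.mono_left nhdsWithin_le_nhds)
  · exact .of_forall fun N t _ => div_nonneg (fejerKernel_nonneg _ _) (by positivity)
  · intro u hu hxu
    -- The closed interval supplies compactness. As `x₀` is interior, `|(x₀ - t)/2| < π` even at the
    -- endpoints, so the sine vanishes only at `t = x₀`.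
    obtain ⟨c, hc0, hc⟩ : ∃ c > 0, ∀ t ∈ Set.Icc (-Real.pi) Real.pi \ u,
        c ≤ |Real.sin ((x₀ - t) / 2)| := by
      have hK : IsCompact (Set.Icc (-Real.pi) Real.pi \ u) := isCompact_Icc.diff hu
      refine hK.exists_forall_le' (by fun_prop) fun t ht => abs_pos.mpr fun h => ?_
      have hlt : |(x₀ - t) / 2| < Real.pi :=
        abs_lt.mpr ⟨by linarith [hx₀.1, ht.1.2], by linarith [hx₀.2, ht.1.1]⟩
      have := (Real.sin_eq_zero_iff_of_lt_of_lt (abs_lt.mp hlt).1 (abs_lt.mp hlt).2).mp h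
      have hxt : x₀ = t := by linarith
      exact ht.2 (hxt ▸ hxu)
    have hlim : Tendsto (fun N : ℕ => 1 / ((N : ℝ) + 1) * (1 / c ^ 2) / (2 * Real.pi)) atTop
        (𝓝 0) := by
      have := ((tendsto_one_div_add_atTop_nhds_zero_nat (𝕜 := ℝ)).mul_const (1 / c ^ 2)).div_const
        (2 * Real.pi)
      rwa [zero_mul, zero_div] at this
    rw [Metric.tendstoUniformlyOn_iff]
    intro ε hε
    filter_upwards [hlim.eventually_lt_const hε] with N hN t ht
    have hnn : 0 ≤ fejerKernel N (x₀ - t) / (2 * Real.pi) :=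
      div_nonneg (fejerKernel_nonneg _ _) (by positivity)
    rw [Pi.zero_apply, dist_zero_left, Real.norm_eq_abs, abs_of_nonneg hnn]
    refine lt_of_le_of_lt ?_ hN
    gcongr
    exact fejerKernel_le N hc0 (hc t ⟨Set.Ioo_subset_Icc_self ht.1, ht.2⟩)
  · refine tendsto_const_nhds.congr fun N => ?_
    rw [integral_div, ← integral_Ioc_eq_integral_Ioo,
      ← intervalIntegral.integral_of_le (by linarith), integral_fejerKernel_sub,
      div_self (by positivity)]
  · refine .of_forall fun N => Continuous.aestronglyMeasurable ?_
    exact ((continuous_fejerKernel N).comp (by fun_prop)).div_const _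

/-! ### Integrability and the limit. -/

theorem RiemannHypothesis.continuous_inv_riemannZeta (hRH : RiemannHypothesis) {σ : ℝ}
    (hσ : 1 / 2 < σ) (hσ' : σ < 1) :
    Continuous fun y : ℝ => (riemannZeta ((σ : ℂ) + Complex.I * (y : ℂ)))⁻¹ := by
  have hne : ∀ y : ℝ, (σ : ℂ) + Complex.I * (y : ℂ) ≠ 1 := by
    intro y h
    have := congrArg Complex.re h
    simp at this
    linarith
  refine Continuous.inv₀ ?_ fun y => hRH.riemannZeta_ne_zero (by simpa using hσ) (hne y)
  refine continuous_iff_continuousAt.mpr fun y => ?_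
  exact ContinuousAt.comp (g := riemannZeta) (f := fun y : ℝ => (σ : ℂ) + Complex.I * (y : ℂ))
    (differentiableAt_riemannZeta (hne y)).continuousAt (by fun_prop)

open MeasureTheory in
theorem RiemannHypothesis.integrable_inv_riemannZeta_mul (hRH : RiemannHypothesis) {σ : ℝ}
    (hσ : 1 / 2 < σ) (hσ' : σ < 1) :
    Integrable fun y : ℝ => (1 / (1 / 4 + y ^ 2)) •
      (riemannZeta ((σ : ℂ) + Complex.I * (y : ℂ)))⁻¹ := by
  obtain ⟨C, hC⟩ := hRH.exists_norm_inv_riemannZeta_le hσ hσ'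
  -- The exponent is `-2 + 1/2`, from the weight and the growth of `1/ζ`; the constant is `8 * 2`.
  have hint : Integrable fun y : ℝ => 16 * C * (1 + ‖y‖) ^ (-(3 / 2) : ℝ) :=
    (integrable_one_add_norm (by simp; norm_num)).const_mul _
  refine hint.mono' ?_ (.of_forall fun y => ?_)
  · refine Continuous.aestronglyMeasurable (Continuous.fun_smul ?_
      (hRH.continuous_inv_riemannZeta hσ hσ'))
    exact continuous_const.div (by fun_prop) fun y => by positivity
  · have hC0 : 0 ≤ C := by
      have := (norm_nonneg _).trans (hC 0)
      exact nonneg_of_mul_nonneg_left this (by positivity)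
    have h1 : (0 : ℝ) < 1 + |y| := by positivity
    have h2 : 1 / (1 / 4 + y ^ 2) ≤ 8 * (1 + |y|) ^ (-2 : ℝ) := by
      rw [Real.rpow_neg h1.le, Real.rpow_two, ← div_eq_mul_inv,
        div_le_div_iff₀ (by positivity) (by positivity)]
      nlinarith [sq_nonneg (1 - |y|), sq_abs y]
    have h3 : (4 + |y|) ^ (1 / 2 : ℝ) ≤ 2 * (1 + |y|) ^ (1 / 2 : ℝ) := by
      rw [← Real.sqrt_eq_rpow, ← Real.sqrt_eq_rpow]
      refine Real.sqrt_le_iff.mpr ⟨by positivity, ?_⟩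
      rw [mul_pow, Real.sq_sqrt h1.le]
      linarith [abs_nonneg y]
    rw [norm_smul, Real.norm_eq_abs, abs_of_pos (by positivity)]
    calc _ ≤ 8 * (1 + |y|) ^ (-2 : ℝ) * (C * (2 * (1 + |y|) ^ (1 / 2 : ℝ))) := by
          gcongr
          exact (hC y).trans (by gcongr)
      _ = 16 * C * ((1 + |y|) ^ (-2 : ℝ) * (1 + |y|) ^ (1 / 2 : ℝ)) := by ring
      _ = _ := by rw [← Real.rpow_add h1, Real.norm_eq_abs]; norm_num

theorem theorem4p1 (hRH : RiemannHypothesis) (σ : ℝ) (hσ : 1 / 2 < σ) (hσ' : σ < 1)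
    (x₀ : ℝ) (hx₀ : x₀ ∈ Set.Ioo (-Real.pi) Real.pi) :
    (∀ N : ℕ, MeasureTheory.Integrable (fun y : ℝ =>
      (fejerKernel N (x₀ - 2 * Real.arctan (2 * y)) : ℂ) /
        (riemannZeta ((σ : ℂ) + Complex.I * (y : ℂ)) * (1 / 4 + (y : ℂ) ^ 2)))
      MeasureTheory.volume) ∧
    Filter.Tendsto (fun N : ℕ =>
      1 / (2 * (Real.pi : ℂ)) * ∫ y : ℝ,
        (fejerKernel N (x₀ - 2 * Real.arctan (2 * y)) : ℂ) /
          (riemannZeta ((σ : ℂ) + Complex.I * (y : ℂ)) * (1 / 4 + (y : ℂ) ^ 2)))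
      Filter.atTop
      (nhds (1 / riemannZeta ((σ : ℂ) + Complex.I / 2 * (Real.tan (x₀ / 2) : ℂ)))) := by
  have hpi := Real.pi_pos
  have hint := hRH.integrable_inv_riemannZeta_mul hσ hσ'
  have hcont := hRH.continuous_inv_riemannZeta hσ hσ'
  have heq : ∀ (N : ℕ) (y : ℝ), (fejerKernel N (x₀ - 2 * Real.arctan (2 * y)) : ℂ) /
        (riemannZeta ((σ : ℂ) + Complex.I * (y : ℂ)) * (1 / 4 + (y : ℂ) ^ 2))
      = fejerKernel N (x₀ - 2 * Real.arctan (2 * y)) • ((1 / (1 / 4 + y ^ 2)) •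
        (riemannZeta ((σ : ℂ) + Complex.I * (y : ℂ)))⁻¹) := by
    intro N y
    rw [Complex.real_smul, Complex.real_smul, div_eq_mul_inv, mul_inv]
    push_cast
    rw [one_div, one_div]
    ring
  have hdiv : ∀ y : ℝ, |1 / (1 / 4 + y ^ 2)| = 1 / (1 / 4 + y ^ 2) := fun y =>
    abs_of_pos (by positivity)
  have hder : ∀ y ∈ Set.univ, HasDerivWithinAt (fun y : ℝ => 2 * Real.arctan (2 * y))
      (1 / (1 / 4 + y ^ 2)) Set.univ y :=
    fun y _ => (hasDerivAt_two_mul_arctan_two_mul y).hasDerivWithinAt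
  have hinj := injective_two_mul_arctan_two_mul.injOn (s := Set.univ)
  set F : ℝ → ℂ := fun t =>
    (riemannZeta ((σ : ℂ) + Complex.I * ((Real.tan (t / 2) / 2 : ℝ) : ℂ)))⁻¹
  have hFy : ∀ y : ℝ, F (2 * Real.arctan (2 * y))
      = (riemannZeta ((σ : ℂ) + Complex.I * (y : ℂ)))⁻¹ := by
    intro y
    simp only [F]
    rw [mul_div_cancel_left₀ _ two_ne_zero, Real.tan_arctan, mul_div_cancel_left₀ _ two_ne_zero]
  have hF : MeasureTheory.IntegrableOn F (Set.Ioo (-Real.pi) Real.pi) := by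
    rw [← image_two_mul_arctan_two_mul,
      MeasureTheory.integrableOn_image_iff_integrableOn_abs_deriv_smul MeasurableSet.univ hder hinj,
      MeasureTheory.integrableOn_univ]
    simpa only [hdiv, hFy] using hint
  have hFc : ContinuousAt F x₀ := by
    have hcos : Real.cos (x₀ / 2) ≠ 0 :=
      (Real.cos_pos_of_mem_Ioo ⟨by linarith [hx₀.1], by linarith [hx₀.2]⟩).ne'
    have htan : ContinuousAt (fun t : ℝ => Real.tan (t / 2) / 2) x₀ :=
      (ContinuousAt.comp (g := Real.tan) (f := fun t : ℝ => t / 2)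
        (Real.continuousAt_tan.mpr hcos) (by fun_prop)).div_const 2
    exact ContinuousAt.comp (g := fun y : ℝ => (riemannZeta ((σ : ℂ) + Complex.I * (y : ℂ)))⁻¹)
      hcont.continuousAt htan
  constructor
  · intro N
    simp only [heq]
    -- The kernel's argument stays in `[-2π, 2π]`, so the kernel is a bounded factor.
    obtain ⟨C, hC⟩ := isCompact_Icc.exists_bound_of_continuousOn
      (s := Set.Icc (-(2 * Real.pi)) (2 * Real.pi)) (continuous_fejerKernel N).continuousOn
    refine hint.bdd_smul C ?_ (.of_forall fun y => hC _ ⟨?_, ?_⟩)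
    · exact ((continuous_fejerKernel N).comp
        (by fun_prop (disch := exact Real.continuous_arctan))).aestronglyMeasurable
    · linarith [hx₀.1, Real.arctan_lt_pi_div_two (2 * y)]
    · linarith [hx₀.2, Real.neg_pi_div_two_lt_arctan (2 * y)]
  · have hlim := tendsto_integral_fejerKernel_smul hx₀ hF hFc
    have hval : F x₀ = 1 / riemannZeta ((σ : ℂ) + Complex.I / 2 * (Real.tan (x₀ / 2) : ℂ)) := by
      simp only [F, one_div]
      congr 3
      push_cast
      ring
    rw [hval] at hlim
    refine hlim.congr fun N => ?_
    rw [← image_two_mul_arctan_two_mul, MeasureTheory.integral_image_eq_integral_abs_deriv_smul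
      MeasurableSet.univ hder hinj, MeasureTheory.setIntegral_univ,
      ← MeasureTheory.integral_const_mul]
    refine MeasureTheory.integral_congr_ae (.of_forall fun y => ?_)
    simp only [heq, hdiv, hFy, Complex.real_smul]
    push_cast
    ring
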